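/- Let $n\ge 1$ and let $T$ be a track $n$-category, that is, a strict $n$-category all of whose $n$-cells are invertible for $\star_{n-1}$. Let $T_{n-1}$ be its $(n-1)$-category of $(n-1)$-cells, and let $\overline T$ be the $(n-1)$-category presented by $T$: the quotient of $T_{n-1}$ identifying two $(n-1)$-cells whenever some $n$-cell goes from one to the other; write $\overline u$ for the class of $u$. A context of an $m$-category $\mathcal C$ is an $m$-cell $C$ of the $m$-category $\mathcal C[x]$, obtained by freely adjoining an $m$-cell $x$ with prescribed boundary, that contains exactly one occurrence of $x$. The category $\mathrm{Ct}(\mathcal C)$ has the $m$-cells of $\mathcal C$ as objects, and a morphism $u\to v$ is a context $C$ on the boundary of $u$ with $C[u]=v$. A natural system on $\mathcal C$ is a functor $D$ from $\mathrm{Ct}(\mathcal C)$ to groups; it is abelian when every $D_u$ is abelian. Let $\mathrm{Aut}^T$ be the natural system on $T_{n-1}$ sending $u$ to the group of closed $n$-cells $f:u\to u$ and a context $C$ to $f\mapsto C[f]$. For a natural system $D$ on $\overline T$, let $\widehat D$ be its pullback to $T_{n-1}$, so $\widehat D_u=D_{\overline u}$. Call $T$ abelian when every group $\mathrm{Aut}^T_u$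 is abelian, and linear when there is an abelian natural system $D$ on $\overline T$ such that $\widehat D$ is isomorphic to $\mathrm{Aut}^T$. Theorem. $T$ is abelian if and only if it is linear. Moreover, suppose that $T$ is abelian. For an $(n-1)$-cell $u$ of $\overline T$, let $\Pi(T)_u$ be the abelian group with one generator $[f]$ for each closed $n$-cell $f:a\to a$ with $\overline a=u$, and relations $[f\star_{n-1}g]=[f]+[g]$ for $f,g:a\to a$ with $\overline a=u$, and $[f\star_{n-1}g]=[g\star_{n-1}f]$ for $f:a\to b$ and $g:b\to a$ with $\overline a=\overline b=u$. Then: 1. These groups form an abelian natural system $\Pi(T)$ on $\overline T$ in which $\overline B$ sends $[f]$ to $[B[f]]$, for every closed $n$-cell $f$ with base $a$ and every context $B$ of $T_{n-1}$ starting at $a$. 2. There is an isomorphism $\Phi:\widehat{\Pi(T)}\to\mathrm{Aut}^T$ such that $\Phi_u([f])=g^-\star_{n-1}f\star_{n-1}g$ for every closed $f:v\to v$ and every $n$-cell $g:v\to u$. It is conjugation invariant, where an isomorphism $\Psi:\widehat D\to\mathrm{Aut}^T$ is called conjugation invariant if $\Psi_u(d)=g^-\star_{n-1}\Psi_v(d)\star_{n-1}g$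 for every $n$-cell $g:v\to u$ and every $d\in D_{\overline v}=D_{\overline u}$. 3. (Uniqueness up to isomorphism.) For every natural system $D$ on $\overline T$ and every conjugation invariant isomorphism $\Psi:\widehat D\to\mathrm{Aut}^T$, there is exactly one isomorphism $\theta:D\to\Pi(T)$ with $\Phi\circ\widehat\theta=\Psi$. For every natural system $D$ on $\overline T$ with $\widehat D$ isomorphic to $\mathrm{Aut}^T$ (by any isomorphism), each group $D_u$ is isomorphic to $\Pi(T)_u$. -/

import Mathlib

open CategoryTheory

universe w

noncomputable section

/-- A strict `n`-category, in the one-sorted presentation: `Cell` is the set of all `n`-cells, and for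
`k < n` a `k`-cell is identified with the identity `n`-cell on it, that is, with an `n`-cell `a` such
that `src k a = a`. For `i < n`, `src i` and `tgt i` are the `i`-source and the `i`-target, and
`comp i a b` is the composite `a ⋆ᵢ b`, defined when `tgt i a = src i b`. A `0`-category is a set. -/
structure NCat (n : ℕ) where
  /-- the cells -/
  Cell : Type w
  /-- the `i`-source -/
  src : Fin n → Cell → Cell
  /-- the `i`-target -/
  tgt : Fin n → Cell → Cell
  /-- the `i`-composite -/
  comp : ∀ (i : Fin n) (a b : Cell), tgt i a = src i b → Cell
  src_src_of_le : ∀ {i j : Fin n} (a : Cell), i ≤ j → src j (src i a) = src i a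
  tgt_src_of_le : ∀ {i j : Fin n} (a : Cell), i ≤ j → tgt j (src i a) = src i a
  src_tgt_of_le : ∀ {i j : Fin n} (a : Cell), i ≤ j → src j (tgt i a) = tgt i a
  tgt_tgt_of_le : ∀ {i j : Fin n} (a : Cell), i ≤ j → tgt j (tgt i a) = tgt i a
  src_src_of_lt : ∀ {i j : Fin n} (a : Cell), i < j → src i (src j a) = src i a
  src_tgt_of_lt : ∀ {i j : Fin n} (a : Cell), i < j → src i (tgt j a) = src i a
  tgt_src_of_lt : ∀ {i j : Fin n} (a : Cell), i < j → tgt i (src j a) = tgt i a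
  tgt_tgt_of_lt : ∀ {i j : Fin n} (a : Cell), i < j → tgt i (tgt j a) = tgt i a
  src_comp : ∀ (i : Fin n) (a b : Cell) (h : tgt i a = src i b), src i (comp i a b h) = src i a
  tgt_comp : ∀ (i : Fin n) (a b : Cell) (h : tgt i a = src i b), tgt i (comp i a b h) = tgt i b
  src_comp_of_lt : ∀ {i j : Fin n} (a b : Cell) (h : tgt i a = src i b)
    (h' : tgt i (src j a) = src i (src j b)), i < j →
    src j (comp i a b h) = comp i (src j a) (src j b) h'
  tgt_comp_of_lt : ∀ {i j : Fin n} (a b : Cell) (h : tgt i a = src i b)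
    (h' : tgt i (tgt j a) = src i (tgt j b)), i < j →
    tgt j (comp i a b h) = comp i (tgt j a) (tgt j b) h'
  assoc : ∀ (i : Fin n) (a b c : Cell) (h₁ : tgt i a = src i b) (h₂ : tgt i b = src i c)
    (h₃ : tgt i (comp i a b h₁) = src i c) (h₄ : tgt i a = src i (comp i b c h₂)),
    comp i (comp i a b h₁) c h₃ = comp i a (comp i b c h₂) h₄
  id_comp : ∀ (i : Fin n) (a : Cell) (h : tgt i (src i a) = src i a), comp i (src i a) a h = a
  comp_id : ∀ (i : Fin n) (a : Cell) (h : tgt i a = src i (tgt i a)), comp i a (tgt i a) h = a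
  exchange : ∀ {i j : Fin n} (a b c d : Cell) (hab : tgt j a = src j b) (hcd : tgt j c = src j d)
    (hac : tgt i a = src i c) (hbd : tgt i b = src i d)
    (h₁ : tgt i (comp j a b hab) = src i (comp j c d hcd))
    (h₂ : tgt j (comp i a c hac) = src j (comp i b d hbd)), i < j →
    comp i (comp j a b hab) (comp j c d hcd) h₁ = comp j (comp i a c hac) (comp i b d hbd) h₂

namespace NCat

variable {n : ℕ}

theorem comp_congr (C : NCat.{w} n) (i : Fin n) {a a' b b' : C.Cell} (ha : a = a') (hb : b = b')
    (h : C.tgt i a = C.src i b) (h' : C.tgt i a' = C.src i b') :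
    C.comp i a b h = C.comp i a' b' h' := by
  subst ha hb; rfl

/-- A (strict) `n`-functor. -/
structure Functor (C D : NCat.{w} n) where
  /-- the map on cells -/
  map : C.Cell → D.Cell
  map_src : ∀ (i : Fin n) (a : C.Cell), map (C.src i a) = D.src i (map a)
  map_tgt : ∀ (i : Fin n) (a : C.Cell), map (C.tgt i a) = D.tgt i (map a)
  map_comp : ∀ (i : Fin n) (a b : C.Cell) (h : C.tgt i a = C.src i b)
    (h' : D.tgt i (map a) = D.src i (map b)),
    map (C.comp i a b h) = D.comp i (map a) (map b) h'

/-! ### Contexts -/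

/-- Formal composites of cells of `C` and of an indeterminate `n`-cell `x` (`hole`) whose boundary is
that of the `n`-cell `u`. `Term C u g` is the type of those whose value at `x = u` is `g`. As `x` is
parallel to `u`, the `i`-source and `i`-target of a formal composite (`i < n`) are those of its value
`g`, so that composability can be read off the values. -/
inductive Term (C : NCat.{w} n) (u : C.Cell) : C.Cell → Type w
  | cell (a : C.Cell) : Term C u a
  | hole : Term C u u
  | comp (i : Fin n) {a b g : C.Cell} (p : Term C u a) (q : Term C u b)
      (h : C.tgt i a = C.src i b) (e : C.comp i a b h = g) : Term C u g

namespace Term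

/-- The congruence presenting the `n`-category `C[x]` obtained from `C` by freely adjoining the
`n`-cell `x`: the axioms of `n`-categories, and the composites that already exist in `C`. -/
inductive Rel (C : NCat.{w} n) (u : C.Cell) :
    ∀ {a b : C.Cell}, Term C u a → Term C u b → Prop
  | refl {a : C.Cell} (p : Term C u a) : Rel C u p p
  | symm {a b : C.Cell} {p : Term C u a} {q : Term C u b} : Rel C u p q → Rel C u q p
  | trans {a b c : C.Cell} {p : Term C u a} {q : Term C u b} {r : Term C u c} :
      Rel C u p q → Rel C u q r → Rel C u p r
  | congr (i : Fin n) {a a' b b' g g' : C.Cell} {p : Term C u a} {p' : Term C u a'}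
      {q : Term C u b} {q' : Term C u b'} (h : C.tgt i a = C.src i b) (e : C.comp i a b h = g)
      (h' : C.tgt i a' = C.src i b') (e' : C.comp i a' b' h' = g') :
      Rel C u p p' → Rel C u q q' → Rel C u (p.comp i q h e) (p'.comp i q' h' e')
  | cell_comp (i : Fin n) {a b g : C.Cell} (h : C.tgt i a = C.src i b) (e : C.comp i a b h = g) :
      Rel C u (comp i (cell a) (cell b) h e) (cell g)
  | assoc (i : Fin n) {a b c ab bc g g' : C.Cell} (p : Term C u a) (q : Term C u b)
      (r : Term C u c) (h₁ : C.tgt i a = C.src i b) (e₁ : C.comp i a b h₁ = ab)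
      (h₂ : C.tgt i b = C.src i c) (e₂ : C.comp i b c h₂ = bc)
      (h₃ : C.tgt i ab = C.src i c) (e₃ : C.comp i ab c h₃ = g)
      (h₄ : C.tgt i a = C.src i bc) (e₄ : C.comp i a bc h₄ = g') :
      Rel C u ((p.comp i q h₁ e₁).comp i r h₃ e₃) (p.comp i (q.comp i r h₂ e₂) h₄ e₄)
  | id_comp (i : Fin n) {a g : C.Cell} (p : Term C u a) (h : C.tgt i (C.src i a) = C.src i a)
      (e : C.comp i (C.src i a) a h = g) : Rel C u (comp i (cell (C.src i a)) p h e) p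
  | comp_id (i : Fin n) {a g : C.Cell} (p : Term C u a) (h : C.tgt i a = C.src i (C.tgt i a))
      (e : C.comp i a (C.tgt i a) h = g) : Rel C u (comp i p (cell (C.tgt i a)) h e) p
  | exchange {i j : Fin n} (hij : i < j) {a b c d ab cd ac bd g g' : C.Cell}
      (p : Term C u a) (q : Term C u b) (r : Term C u c) (s : Term C u d)
      (hab : C.tgt j a = C.src j b) (eab : C.comp j a b hab = ab)
      (hcd : C.tgt j c = C.src j d) (ecd : C.comp j c d hcd = cd)
      (hac : C.tgt i a = C.src i c) (eac : C.comp i a c hac = ac)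
      (hbd : C.tgt i b = C.src i d) (ebd : C.comp i b d hbd = bd)
      (h₁ : C.tgt i ab = C.src i cd) (e₁ : C.comp i ab cd h₁ = g)
      (h₂ : C.tgt j ac = C.src j bd) (e₂ : C.comp j ac bd h₂ = g') :
      Rel C u ((p.comp j q hab eab).comp i (r.comp j s hcd ecd) h₁ e₁)
        ((p.comp i r hac eac).comp j (q.comp i s hbd ebd) h₂ e₂)

/-- The number of occurrences of the indeterminate. It is invariant under `Rel`. -/
def occ {C : NCat.{w} n} {u : C.Cell} : ∀ {g : C.Cell}, Term C u g → ℕ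
  | _, cell _ => 0
  | _, hole => 1
  | _, comp _ p q _ _ => p.occ + q.occ

theorem Rel.occ_eq {C : NCat.{w} n} {u a b : C.Cell} {p : Term C u a} {q : Term C u b}
    (h : Rel C u p q) : p.occ = q.occ := by
  induction h <;> simp_all [occ] <;> omega

/-- Substitution of a formal composite for the indeterminate. -/
def subst {C : NCat.{w} n} {u v : C.Cell} (t : Term C u v) :
    ∀ {g : C.Cell}, Term C v g → Term C u g
  | _, cell a => cell a
  | _, hole => t
  | _, comp i p q h e => comp i (subst t p) (subst t q) h e

theorem occ_subst {C : NCat.{w} n} {u v g : C.Cell} (t : Term C u v) (p : Term C v g) :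
    (subst t p).occ = p.occ * t.occ := by
  induction p with
  | cell a => simp [subst, occ]
  | hole => simp [subst, occ]
  | comp i p q h e ihp ihq => simp [subst, occ, ihp, ihq, add_mul]

theorem subst_hole {C : NCat.{w} n} {u g : C.Cell} (p : Term C u g) : subst hole p = p := by
  induction p with
  | cell a => rfl
  | hole => rfl
  | comp i p q h e ihp ihq => simp [subst, ihp, ihq]

theorem subst_subst {C : NCat.{w} n} {u v x g : C.Cell} (t : Term C u v) (s : Term C v x)
    (p : Term C x g) : subst t (subst s p) = subst (subst t s) p := by
  induction p with
  | cell a => rfl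
  | hole => rfl
  | comp i p q h e ihp ihq => simp [subst, ihp, ihq]

theorem Rel.subst_left {C : NCat.{w} n} {u v : C.Cell} {t t' : Term C u v} (h : Rel C u t t')
    {g : C.Cell} (p : Term C v g) : Rel C u (Term.subst t p) (Term.subst t' p) := by
  induction p with
  | cell a => exact .refl _
  | hole => exact h
  | comp i p q h e ihp ihq => exact .congr i _ _ _ _ ihp ihq

theorem Rel.subst_right {C : NCat.{w} n} {u v : C.Cell} (t : Term C u v) {a b : C.Cell}
    {p : Term C v a} {q : Term C v b} (h : Rel C v p q) :
    Rel C u (Term.subst t p) (Term.subst t q) := by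
  induction h with
  | refl p => exact .refl _
  | symm _ ih => exact .symm ih
  | trans _ _ ih₁ ih₂ => exact .trans ih₁ ih₂
  | congr i h e h' e' _ _ ih₁ ih₂ => exact .congr i _ _ _ _ ih₁ ih₂
  | cell_comp i h e => exact .cell_comp i h e
  | assoc i p q r h₁ e₁ h₂ e₂ h₃ e₃ h₄ e₄ => exact .assoc i _ _ _ h₁ e₁ h₂ e₂ h₃ e₃ h₄ e₄
  | id_comp i p h e => exact .id_comp i _ h e
  | comp_id i p h e => exact .comp_id i _ h e
  | exchange hij p q r s hab eab hcd ecd hac eac hbd ebd h₁ e₁ h₂ e₂ =>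
    exact .exchange hij _ _ _ _ hab eab hcd ecd hac eac hbd ebd h₁ e₁ h₂ e₂

/-- The image of a formal composite under an `n`-functor. -/
def map {C D : NCat.{w} n} (F : C.Functor D) {u : C.Cell} :
    ∀ {g : C.Cell}, Term C u g → Term D (F.map u) (F.map g)
  | _, cell a => cell (F.map a)
  | _, hole => hole
  | _, comp i p q h e =>
    have h' := by rw [← F.map_tgt, ← F.map_src, h]
    comp i (map F p) (map F q) h' (by rw [← e, F.map_comp i _ _ h h'])

theorem occ_map {C D : NCat.{w} n} (F : C.Functor D) {u g : C.Cell} (p : Term C u g) :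
    (map F p).occ = p.occ := by
  induction p with
  | cell a => rfl
  | hole => rfl
  | comp i p q h e ihp ihq => simp [map, occ, ihp, ihq]

theorem map_subst {C D : NCat.{w} n} (F : C.Functor D) {u v g : C.Cell} (t : Term C u v)
    (p : Term C v g) : map F (subst t p) = subst (map F t) (map F p) := by
  induction p with
  | cell a => rfl
  | hole => rfl
  | comp i p q h e ihp ihq => simp [map, subst, ihp, ihq]

theorem Rel.map {C D : NCat.{w} n} (F : C.Functor D) {u a b : C.Cell} {p : Term C u a}
    {q : Term C u b} (h : Rel C u p q) : Rel D (F.map u) (Term.map F p) (Term.map F q) := by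
  induction h with
  | refl p => exact .refl _
  | symm _ ih => exact .symm ih
  | trans _ _ ih₁ ih₂ => exact .trans ih₁ ih₂
  | congr i h e h' e' _ _ ih₁ ih₂ => exact .congr i _ _ _ _ ih₁ ih₂
  | cell_comp i h e => exact .cell_comp i _ _
  | assoc i p q r h₁ e₁ h₂ e₂ h₃ e₃ h₄ e₄ => exact .assoc i _ _ _ _ _ _ _ _ _ _ _
  | @id_comp i a g p h e =>
    have aux : ∀ (x : D.Cell) (hx : x = D.src i (F.map a)) (h' : D.tgt i x = D.src i (F.map a))
        (e' : D.comp i x (F.map a) h' = F.map g),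
        Rel D (F.map u) (Term.comp i (Term.cell x) (Term.map F p) h' e') (Term.map F p) := by
      intro x hx h' e'; subst hx; exact .id_comp i _ _ _
    exact aux _ (F.map_src i a) _ _
  | @comp_id i a g p h e =>
    have aux : ∀ (x : D.Cell) (hx : x = D.tgt i (F.map a)) (h' : D.tgt i (F.map a) = D.src i x)
        (e' : D.comp i (F.map a) x h' = F.map g),
        Rel D (F.map u) (Term.comp i (Term.map F p) (Term.cell x) h' e') (Term.map F p) := by
      intro x hx h' e'; subst hx; exact .comp_id i _ _ _
    exact aux _ (F.map_tgt i a) _ _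
  | exchange hij p q r s hab eab hcd ecd hac eac hbd ebd h₁ e₁ h₂ e₂ =>
    exact .exchange hij _ _ _ _ _ _ _ _ _ _ _ _ _ _ _ _

end Term

/-- Equality in `C[x]` of formal composites with exactly one occurrence of `x`. -/
def ctxSetoid (C : NCat.{w} n) (u g : C.Cell) : Setoid {p : Term C u g // p.occ = 1} where
  r p q := Term.Rel C u p.1 q.1
  iseqv := ⟨fun _ => .refl _, fun h => .symm h, fun h₁ h₂ => .trans h₁ h₂⟩

/-- The contexts `C` with the boundary of the `n`-cell `u` as hole and such that `C[u] = g`: the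
`n`-cells of `C[x]` with exactly one occurrence of `x`, with value `g` at `u`. -/
def Context (C : NCat.{w} n) (u g : C.Cell) : Type w := Quotient (C.ctxSetoid u g)

/-- The category of contexts of `C`; its objects are the `n`-cells of `C`. -/
structure Ct (C : NCat.{w} n) where
  /-- the underlying `n`-cell -/
  cell : C.Cell

/-- The context given by a formal composite. -/
def Context.mk {C : NCat.{w} n} {u g : C.Cell} (p : Term C u g) (hp : p.occ = 1) :
    Context C u g := Quotient.mk (C.ctxSetoid u g) ⟨p, hp⟩

/-- Morphisms from `u` to `g` are the contexts `C` with `C[u] = g`; they are composed by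
substitution. -/
instance (C : NCat.{w} n) : Category.{w} (Ct C) where
  Hom u g := Context C u.cell g.cell
  id u := Context.mk Term.hole rfl
  comp {_ _ _} K L := Quotient.liftOn₂ K L
    (fun t p => Context.mk (Term.subst t.1 p.1) (by rw [Term.occ_subst, t.2, p.2]))
    (fun _ p _ _ h₁ h₂ => Quotient.sound
      (Term.Rel.trans (Term.Rel.subst_left h₁ p.1) (Term.Rel.subst_right _ h₂)))
  id_comp := by
    rintro ⟨u⟩ ⟨v⟩ ⟨p⟩
    exact congrArg (Quotient.mk _) (Subtype.ext (Term.subst_hole p.1))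
  comp_id := by
    rintro ⟨u⟩ ⟨v⟩ ⟨p⟩
    rfl
  assoc := by
    rintro ⟨u⟩ ⟨v⟩ ⟨x⟩ ⟨y⟩ ⟨p⟩ ⟨q⟩ ⟨r⟩
    exact congrArg (Quotient.mk _) (Subtype.ext (Term.subst_subst p.1 q.1 r.1).symm)

/-- The functor between categories of contexts induced by an `n`-functor. -/
def Ct.map {C D : NCat.{w} n} (F : C.Functor D) : Ct C ⥤ Ct D where
  obj u := ⟨F.map u.cell⟩
  map {_ _} K := Quotient.liftOn K
    (fun p => Context.mk (Term.map F p.1) (by rw [Term.occ_map, p.2]))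
    (fun _ _ h => Quotient.sound (Term.Rel.map F h))
  map_id _ := rfl
  map_comp := by
    rintro ⟨u⟩ ⟨v⟩ ⟨x⟩ ⟨p⟩ ⟨q⟩
    exact congrArg (Quotient.mk _) (Subtype.ext (Term.map_subst F p.1 q.1))

/-- A natural system on `C`: a functor from the category of contexts to groups. -/
abbrev NatSys (C : NCat.{w} n) := Ct C ⥤ GrpCat.{w}

/-- A natural system is abelian when all its groups are. -/
def NatSys.IsAbelian {C : NCat.{w} n} (D : NatSys C) : Prop :=
  ∀ (u : Ct C) (a b : D.obj u), a * b = b * a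

/-- The `n`-category of `n`-cells of an `(n + 1)`-category. -/
def trunc (C : NCat.{w} (n + 1)) : NCat.{w} n where
  Cell := {a : C.Cell // C.src (Fin.last n) a = a}
  src i a := ⟨C.src i.castSucc a.1, C.src_src_of_le _ (Fin.le_last _)⟩
  tgt i a := ⟨C.tgt i.castSucc a.1, C.src_tgt_of_le _ (Fin.le_last _)⟩
  comp i a b h := ⟨C.comp i.castSucc a.1 b.1 (congrArg Subtype.val h), by
    have hl := Fin.castSucc_lt_last i
    have h' : C.tgt i.castSucc (C.src (Fin.last n) a.1) =
        C.src i.castSucc (C.src (Fin.last n) b.1) := by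
      rw [a.2, b.2]; exact congrArg Subtype.val h
    rw [C.src_comp_of_lt _ _ _ h' hl]
    exact C.comp_congr _ a.2 b.2 _ _⟩
  src_src_of_le a h := Subtype.ext (C.src_src_of_le _ h)
  tgt_src_of_le a h := Subtype.ext (C.tgt_src_of_le _ h)
  src_tgt_of_le a h := Subtype.ext (C.src_tgt_of_le _ h)
  tgt_tgt_of_le a h := Subtype.ext (C.tgt_tgt_of_le _ h)
  src_src_of_lt a h := Subtype.ext (C.src_src_of_lt _ h)
  src_tgt_of_lt a h := Subtype.ext (C.src_tgt_of_lt _ h)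
  tgt_src_of_lt a h := Subtype.ext (C.tgt_src_of_lt _ h)
  tgt_tgt_of_lt a h := Subtype.ext (C.tgt_tgt_of_lt _ h)
  src_comp i a b h := Subtype.ext (C.src_comp _ _ _ _)
  tgt_comp i a b h := Subtype.ext (C.tgt_comp _ _ _ _)
  src_comp_of_lt a b h h' hl :=
    Subtype.ext (C.src_comp_of_lt _ _ _ (congrArg Subtype.val h') hl)
  tgt_comp_of_lt a b h h' hl :=
    Subtype.ext (C.tgt_comp_of_lt _ _ _ (congrArg Subtype.val h') hl)
  assoc i a b c h₁ h₂ h₃ h₄ := Subtype.ext (C.assoc _ _ _ _ _ _ _ _)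
  id_comp i a h := Subtype.ext (C.id_comp _ _ _)
  comp_id i a h := Subtype.ext (C.comp_id _ _ _)
  exchange a b c d hab hcd hac hbd h₁ h₂ hl :=
    Subtype.ext (C.exchange _ _ _ _ _ _ _ _ _ _ hl)

end NCat

/-- A track `(m + 1)`-category: an `(m + 1)`-category all of whose `(m + 1)`-cells are invertible for
the top composition. -/
structure TrackCat (m : ℕ) extends NCat.{w} (m + 1) where
  exists_inv : ∀ f : Cell, ∃ (g : Cell) (h : tgt (Fin.last m) f = src (Fin.last m) g)
    (h' : tgt (Fin.last m) g = src (Fin.last m) f),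
    comp (Fin.last m) f g h = src (Fin.last m) f ∧ comp (Fin.last m) g f h' = tgt (Fin.last m) f

namespace TrackCat

variable {m : ℕ} (T : TrackCat.{w} m)

/-- The `m`-category of `m`-cells of a track `(m + 1)`-category. -/
abbrev base : NCat.{w} m := T.toNCat.trunc

/-- The `(m + 1)`-cells with source `a` and target `b`, for `m`-cells `a` and `b`. -/
def Arrow (a b : T.base.Cell) : Type w :=
  {f : T.Cell // T.src (Fin.last m) f = a.1 ∧ T.tgt (Fin.last m) f = b.1}

namespace Arrow

variable {T}

@[ext] theorem ext {a b : T.base.Cell} {f g : T.Arrow a b} (h : f.1 = g.1) : f = g :=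
  Subtype.ext h

/-- The identity of an `m`-cell. -/
def id (a : T.base.Cell) : T.Arrow a a :=
  ⟨a.1, a.2, by
    have h := T.tgt_src_of_le a.1 (le_refl (Fin.last m))
    rwa [a.2] at h⟩

/-- The top composition of `(m + 1)`-cells. -/
def comp {a b c : T.base.Cell} (f : T.Arrow a b) (g : T.Arrow b c) : T.Arrow a c :=
  ⟨T.comp (Fin.last m) f.1 g.1 (f.2.2.trans g.2.1.symm),
    (T.src_comp _ _ _ _).trans f.2.1, (T.tgt_comp _ _ _ _).trans g.2.2⟩

theorem assoc {a b c d : T.base.Cell} (f : T.Arrow a b) (g : T.Arrow b c) (h : T.Arrow c d) :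
    (f.comp g).comp h = f.comp (g.comp h) :=
  ext (T.assoc _ _ _ _ _ _ _ _)

theorem id_comp {a b : T.base.Cell} (f : T.Arrow a b) : (id a).comp f = f := by
  apply ext
  exact (T.comp_congr _ f.2.1.symm rfl _ (by
    rw [T.tgt_src_of_le _ le_rfl])).trans (T.id_comp _ f.1 _)

theorem comp_id {a b : T.base.Cell} (f : T.Arrow a b) : f.comp (id b) = f := by
  apply ext
  exact (T.comp_congr _ rfl f.2.2.symm _ (by
    rw [T.src_tgt_of_le _ le_rfl])).trans (T.comp_id _ f.1 _)

theorem exists_inv {a b : T.base.Cell} (f : T.Arrow a b) :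
    ∃ g : T.Arrow b a, f.comp g = id a ∧ g.comp f = id b := by
  obtain ⟨g, h, h', e, e'⟩ := T.exists_inv f.1
  exact ⟨⟨g, h.symm.trans f.2.2, h'.trans f.2.1⟩, ext (e.trans f.2.1), ext (e'.trans f.2.2)⟩

/-- The inverse of an `(m + 1)`-cell. -/
def inv {a b : T.base.Cell} (f : T.Arrow a b) : T.Arrow b a := f.exists_inv.choose

theorem comp_inv {a b : T.base.Cell} (f : T.Arrow a b) : f.comp f.inv = id a :=
  f.exists_inv.choose_spec.1

theorem inv_comp {a b : T.base.Cell} (f : T.Arrow a b) : f.inv.comp f = id b :=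
  f.exists_inv.choose_spec.2

/-- The conjugate `g⁻ ⋆ f ⋆ g`, a closed cell with base `u`, of a closed cell `f` with base `v` by
an `(m + 1)`-cell `g : v → u`. -/
def conj {v u : T.base.Cell} (g : T.Arrow v u) (f : T.Arrow v v) : T.Arrow u u :=
  (g.inv.comp f).comp g

/-- The group of closed `(m + 1)`-cells with base `a`. -/
instance (a : T.base.Cell) : Group (T.Arrow a a) where
  mul f g := f.comp g
  one := id a
  inv f := f.inv
  mul_assoc := assoc
  one_mul := id_comp
  mul_one := comp_id
  inv_mul_cancel := inv_comp

theorem mul_def {a : T.base.Cell} (f g : T.Arrow a a) : f * g = f.comp g := rfl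

theorem one_def (a : T.base.Cell) : (1 : T.Arrow a a) = id a := rfl

/-- The `i`-composite of closed `(m + 1)`-cells, for `i < m`. -/
def hcomp (i : Fin m) {a b g : T.base.Cell} (h : T.base.tgt i a = T.base.src i b)
    (e : T.base.comp i a b h = g) (f : T.Arrow a a) (f' : T.Arrow b b) : T.Arrow g g :=
  have hl := Fin.castSucc_lt_last i
  have hv : T.tgt i.castSucc a.1 = T.src i.castSucc b.1 := congrArg Subtype.val h
  have h₀ : T.tgt i.castSucc f.1 = T.src i.castSucc f'.1 := by
    rw [← T.tgt_src_of_lt f.1 hl, ← T.src_src_of_lt f'.1 hl, f.2.1, f'.2.1, hv]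
  ⟨T.comp i.castSucc f.1 f'.1 h₀, by
    rw [T.src_comp_of_lt f.1 f'.1 h₀ (by rw [f.2.1, f'.2.1, hv]) hl, ← e]
    exact T.comp_congr _ f.2.1 f'.2.1 _ _, by
    rw [T.tgt_comp_of_lt f.1 f'.1 h₀ (by rw [f.2.2, f'.2.2, hv]) hl, ← e]
    exact T.comp_congr _ f.2.2 f'.2.2 _ _⟩

/-- The closed `(m + 1)`-cell `C[f]`, for `f` a closed `(m + 1)`-cell with base `u` and `C` a formal
composite of `m`-cells: `f` is substituted for the indeterminate. -/
def act {u : T.base.Cell} (f : T.Arrow u u) :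
    ∀ {g : T.base.Cell}, NCat.Term T.base u g → T.Arrow g g
  | _, .cell a => id a
  | _, .hole => f
  | _, .comp i p q h e => hcomp i h e (act f p) (act f q)

theorem hcomp_mul (i : Fin m) {a b g : T.base.Cell} (h : T.base.tgt i a = T.base.src i b)
    (e : T.base.comp i a b h = g) (f k : T.Arrow a a) (f' k' : T.Arrow b b) :
    hcomp i h e (f * k) (f' * k') = hcomp i h e f f' * hcomp i h e k k' :=
  ext (T.exchange _ _ _ _ _ _ _ _ _ _ (Fin.castSucc_lt_last i))

theorem act_mul {u : T.base.Cell} (f k : T.Arrow u u) {g : T.base.Cell}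
    (p : NCat.Term T.base u g) : act (f * k) p = act f p * act k p := by
  induction p with
  | cell a => exact (id_comp _).symm
  | hole => rfl
  | comp i p q h e ihp ihq => simp only [act, ihp, ihq, hcomp_mul]

theorem act_subst {u v g : T.base.Cell} (f : T.Arrow u u) (t : NCat.Term T.base u v)
    (p : NCat.Term T.base v g) : act f (NCat.Term.subst t p) = act (act f t) p := by
  induction p with
  | cell a => rfl
  | hole => rfl
  | comp i p q h e ihp ihq => simp only [act, NCat.Term.subst, ihp, ihq]

theorem src_val {a : T.base.Cell} (f : T.Arrow a a) (i : Fin m) :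
    T.src i.castSucc f.1 = T.src i.castSucc a.1 := by
  rw [← T.src_src_of_lt f.1 (Fin.castSucc_lt_last i), f.2.1]

theorem tgt_val {a : T.base.Cell} (f : T.Arrow a a) (i : Fin m) :
    T.tgt i.castSucc f.1 = T.tgt i.castSucc a.1 := by
  rw [← T.tgt_src_of_lt f.1 (Fin.castSucc_lt_last i), f.2.1]

theorem act_rel {u a b : T.base.Cell} (f : T.Arrow u u) {p : NCat.Term T.base u a}
    {q : NCat.Term T.base u b} (h : NCat.Term.Rel T.base u p q) :
    (act f p).1 = (act f q).1 := by
  induction h with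
  | refl p => rfl
  | symm _ ih => exact ih.symm
  | trans _ _ ih₁ ih₂ => exact ih₁.trans ih₂
  | congr i h e h' e' _ _ ih₁ ih₂ => exact T.comp_congr _ ih₁ ih₂ _ _
  | cell_comp i h e => exact congrArg (fun z : T.base.Cell => z.1) e
  | assoc i p q r h₁ e₁ h₂ e₂ h₃ e₃ h₄ e₄ => exact T.assoc _ _ _ _ _ _ _ _
  | id_comp i p h e =>
    exact (T.comp_congr _ (src_val _ i).symm rfl _ (by
      rw [T.tgt_src_of_le _ le_rfl])).trans (T.id_comp _ _ _)
  | comp_id i p h e =>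
    exact (T.comp_congr _ rfl (tgt_val _ i).symm _ (by
      rw [T.src_tgt_of_le _ le_rfl])).trans (T.comp_id _ _ _)
  | exchange hij p q r s hab eab hcd ecd hac eac hbd ebd h₁ e₁ h₂ e₂ =>
    exact T.exchange _ _ _ _ _ _ _ _ _ _ hij

/-- The closed cell `C[f]`, for `C` a context of the `m`-category of `m`-cells. -/
def actCtx {u g : T.base.Cell} (f : T.Arrow u u) (K : NCat.Context T.base u g) : T.Arrow g g :=
  Quotient.liftOn K (fun p => act f p.1) (fun _ _ h => ext (act_rel f h))

end Arrow

/-- The natural system of closed `(m + 1)`-cells, on the `m`-category of `m`-cells: it sends `u` to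
the group of closed cells with base `u`, and a context `C` to `f ↦ C[f]`. -/
def autSys : NCat.NatSys T.base where
  obj u := GrpCat.of (T.Arrow u.cell u.cell)
  map {_ _} K := GrpCat.ofHom (MonoidHom.mk' (fun f => f.actCtx K) (by
    intro f k
    obtain ⟨p⟩ := K
    exact Arrow.act_mul f k p.1))
  map_id _ := rfl
  map_comp := by
    rintro ⟨u⟩ ⟨v⟩ ⟨g⟩ ⟨p⟩ ⟨q⟩
    ext f
    exact congrArg Subtype.val (Arrow.act_subst f p.1 q.1)

/-- A track category is abelian when its groups of closed top-dimensional cells are abelian. -/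
def IsAbelian : Prop := ∀ (u : T.base.Cell) (f g : T.Arrow u u), f * g = g * f

/-! ### The presented category -/

/-- Two `m`-cells are identified when there is an `(m + 1)`-cell between them. As `(m + 1)`-cells are
invertible and closed under all compositions, this is a congruence. -/
def cellSetoid : Setoid T.base.Cell where
  r a b := Nonempty (T.Arrow a b)
  iseqv := ⟨fun a => ⟨Arrow.id a⟩, fun ⟨f⟩ => ⟨f.inv⟩, fun ⟨f⟩ ⟨g⟩ => ⟨f.comp g⟩⟩

/-- The cells of the presented category. -/
def PCell : Type w := Quotient T.cellSetoid

/-- The class of an `m`-cell in the presented category. -/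
def cls (a : T.base.Cell) : T.PCell := Quotient.mk T.cellSetoid a

variable {T} in
theorem cls_eq_iff {a b : T.base.Cell} : T.cls a = T.cls b ↔ Nonempty (T.Arrow a b) :=
  ⟨fun h => Quotient.exact h, fun h => Quotient.sound h⟩

variable {T} in
theorem Arrow.cls_eq {a b : T.base.Cell} (f : T.Arrow a b) : T.cls a = T.cls b :=
  cls_eq_iff.2 ⟨f⟩

variable {T} in
theorem Arrow.src_eq {a b : T.base.Cell} (f : T.Arrow a b) (i : Fin m) :
    T.base.src i a = T.base.src i b := by
  have hl := Fin.castSucc_lt_last i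
  apply Subtype.ext
  have h₁ := T.src_src_of_lt f.1 hl
  have h₂ := T.src_tgt_of_lt f.1 hl
  rw [f.2.1] at h₁
  rw [f.2.2] at h₂
  exact h₁.trans h₂.symm

variable {T} in
theorem Arrow.tgt_eq {a b : T.base.Cell} (f : T.Arrow a b) (i : Fin m) :
    T.base.tgt i a = T.base.tgt i b := by
  have hl := Fin.castSucc_lt_last i
  apply Subtype.ext
  have h₁ := T.tgt_src_of_lt f.1 hl
  have h₂ := T.tgt_tgt_of_lt f.1 hl
  rw [f.2.1] at h₁
  rw [f.2.2] at h₂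
  exact h₁.trans h₂.symm

/-- The source map of the presented category. -/
def psrc (i : Fin m) (x : T.PCell) : T.PCell :=
  Quotient.liftOn x (fun a => T.cls (T.base.src i a)) (fun _ _ ⟨f⟩ => by rw [f.src_eq i])

/-- The target map of the presented category. -/
def ptgt (i : Fin m) (x : T.PCell) : T.PCell :=
  Quotient.liftOn x (fun a => T.cls (T.base.tgt i a)) (fun _ _ ⟨f⟩ => by rw [f.tgt_eq i])

variable {T} in
theorem composable_of_cls {i : Fin m} {a b : T.base.Cell}
    (h : T.cls (T.base.tgt i a) = T.cls (T.base.src i b)) : T.base.tgt i a = T.base.src i b := by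
  obtain ⟨f⟩ := cls_eq_iff.1 h
  have := f.src_eq i
  rwa [T.base.src_tgt_of_le _ le_rfl, T.base.src_src_of_le _ le_rfl] at this

/-- A representative of a cell of the presented category. -/
def rep (x : T.PCell) : T.base.Cell := Quotient.out x

theorem cls_rep (x : T.PCell) : T.cls (T.rep x) = x := Quotient.out_eq x

theorem composable_rep {i : Fin m} {x y : T.PCell} (h : T.ptgt i x = T.psrc i y) :
    T.base.tgt i (T.rep x) = T.base.src i (T.rep y) := by
  apply composable_of_cls
  rw [← T.cls_rep x, ← T.cls_rep y] at h
  exact h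

/-- The composition of the presented category, computed on representatives. -/
def pcomp (i : Fin m) (x y : T.PCell) (h : T.ptgt i x = T.psrc i y) : T.PCell :=
  T.cls (T.base.comp i (T.rep x) (T.rep y) (T.composable_rep h))

theorem cls_comp (i : Fin m) (a b : T.base.Cell) (h : T.base.tgt i a = T.base.src i b)
    (h' : T.ptgt i (T.cls a) = T.psrc i (T.cls b)) :
    T.pcomp i (T.cls a) (T.cls b) h' = T.cls (T.base.comp i a b h) := by
  obtain ⟨f⟩ := cls_eq_iff.1 (T.cls_rep (T.cls a))
  obtain ⟨g⟩ := cls_eq_iff.1 (T.cls_rep (T.cls b))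
  have hl := Fin.castSucc_lt_last i
  have hv : T.tgt i.castSucc a.1 = T.src i.castSucc b.1 := congrArg Subtype.val h
  have h₁ : T.tgt i.castSucc f.1 = T.src i.castSucc g.1 := by
    rw [← T.tgt_tgt_of_lt f.1 hl, ← T.src_tgt_of_lt g.1 hl, f.2.2, g.2.2, hv]
  refine Arrow.cls_eq ⟨T.comp i.castSucc f.1 g.1 h₁, ?_, ?_⟩
  · rw [T.src_comp_of_lt f.1 g.1 h₁ (by rw [T.tgt_src_of_lt _ hl, T.src_src_of_lt _ hl, h₁]) hl]
    exact T.comp_congr _ f.2.1 g.2.1 _ _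
  · rw [T.tgt_comp_of_lt f.1 g.1 h₁ (by rw [T.tgt_tgt_of_lt _ hl, T.src_tgt_of_lt _ hl, h₁]) hl]
    exact T.comp_congr _ f.2.2 g.2.2 _ _

theorem pcomp_cls (i : Fin m) (a b : T.base.Cell) (h' : T.ptgt i (T.cls a) = T.psrc i (T.cls b)) :
    T.pcomp i (T.cls a) (T.cls b) h' = T.cls (T.base.comp i a b (composable_of_cls h')) :=
  T.cls_comp i a b _ h'

/-- The `m`-category presented by a track `(m + 1)`-category: the quotient of the `m`-category of
`m`-cells by the `(m + 1)`-cells. -/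
def presented : NCat.{w} m where
  Cell := T.PCell
  src := T.psrc
  tgt := T.ptgt
  comp := T.pcomp
  src_src_of_le := by rintro i j ⟨a⟩ h; exact congrArg T.cls (T.base.src_src_of_le a h)
  tgt_src_of_le := by rintro i j ⟨a⟩ h; exact congrArg T.cls (T.base.tgt_src_of_le a h)
  src_tgt_of_le := by rintro i j ⟨a⟩ h; exact congrArg T.cls (T.base.src_tgt_of_le a h)
  tgt_tgt_of_le := by rintro i j ⟨a⟩ h; exact congrArg T.cls (T.base.tgt_tgt_of_le a h)
  src_src_of_lt := by rintro i j ⟨a⟩ h; exact congrArg T.cls (T.base.src_src_of_lt a h)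
  src_tgt_of_lt := by rintro i j ⟨a⟩ h; exact congrArg T.cls (T.base.src_tgt_of_lt a h)
  tgt_src_of_lt := by rintro i j ⟨a⟩ h; exact congrArg T.cls (T.base.tgt_src_of_lt a h)
  tgt_tgt_of_lt := by rintro i j ⟨a⟩ h; exact congrArg T.cls (T.base.tgt_tgt_of_lt a h)
  src_comp := by
    rintro i ⟨a⟩ ⟨b⟩ h
    exact (congrArg (T.psrc i) (T.pcomp_cls i a b h)).trans
      (congrArg T.cls (T.base.src_comp i a b _))
  tgt_comp := by
    rintro i ⟨a⟩ ⟨b⟩ h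
    exact (congrArg (T.ptgt i) (T.pcomp_cls i a b h)).trans
      (congrArg T.cls (T.base.tgt_comp i a b _))
  src_comp_of_lt := by
    rintro i j ⟨a⟩ ⟨b⟩ h h' hl
    have k : T.base.tgt i (T.base.src j a) = T.base.src i (T.base.src j b) := composable_of_cls h'
    exact ((congrArg (T.psrc j) (T.pcomp_cls i a b h)).trans
      (congrArg T.cls (T.base.src_comp_of_lt a b _ k hl))).trans
      (T.pcomp_cls i (T.base.src j a) (T.base.src j b) h').symm
  tgt_comp_of_lt := by
    rintro i j ⟨a⟩ ⟨b⟩ h h' hl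
    have k : T.base.tgt i (T.base.tgt j a) = T.base.src i (T.base.tgt j b) := composable_of_cls h'
    exact ((congrArg (T.ptgt j) (T.pcomp_cls i a b h)).trans
      (congrArg T.cls (T.base.tgt_comp_of_lt a b _ k hl))).trans
      (T.pcomp_cls i (T.base.tgt j a) (T.base.tgt j b) h').symm
  assoc := by
    rintro i ⟨a⟩ ⟨b⟩ ⟨c⟩ h₁ h₂ h₃ h₄
    have k₁ : T.base.tgt i a = T.base.src i b := composable_of_cls h₁
    have k₂ : T.base.tgt i b = T.base.src i c := composable_of_cls h₂
    have k₃ : T.base.tgt i (T.base.comp i a b k₁) = T.base.src i c := by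
      rw [T.base.tgt_comp, k₂]
    have k₄ : T.base.tgt i a = T.base.src i (T.base.comp i b c k₂) := by
      rw [T.base.src_comp, k₁]
    have aux₁ : ∀ (x : T.PCell) (_ : x = T.cls (T.base.comp i a b k₁))
        (h : T.ptgt i x = T.psrc i (T.cls c)),
        T.pcomp i x (T.cls c) h = T.cls (T.base.comp i (T.base.comp i a b k₁) c k₃) := by
      rintro _ rfl h; exact T.cls_comp i _ _ _ h
    have aux₂ : ∀ (x : T.PCell) (_ : x = T.cls (T.base.comp i b c k₂))
        (h : T.ptgt i (T.cls a) = T.psrc i x),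
        T.pcomp i (T.cls a) x h = T.cls (T.base.comp i a (T.base.comp i b c k₂) k₄) := by
      rintro _ rfl h; exact T.cls_comp i _ _ _ h
    exact ((aux₁ _ (T.pcomp_cls i a b h₁) h₃).trans
      (congrArg T.cls (T.base.assoc i a b c k₁ k₂ k₃ k₄))).trans
      (aux₂ _ (T.pcomp_cls i b c h₂) h₄).symm
  id_comp := by
    rintro i ⟨a⟩ h
    exact (T.pcomp_cls i (T.base.src i a) a h).trans (congrArg T.cls (T.base.id_comp i a _))
  comp_id := by
    rintro i ⟨a⟩ h
    exact (T.pcomp_cls i a (T.base.tgt i a) h).trans (congrArg T.cls (T.base.comp_id i a _))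
  exchange := by
    rintro i j ⟨a⟩ ⟨b⟩ ⟨c⟩ ⟨d⟩ hab hcd hac hbd h₁ h₂ hl
    have kab : T.base.tgt j a = T.base.src j b := composable_of_cls hab
    have kcd : T.base.tgt j c = T.base.src j d := composable_of_cls hcd
    have kac : T.base.tgt i a = T.base.src i c := composable_of_cls hac
    have kbd : T.base.tgt i b = T.base.src i d := composable_of_cls hbd
    have aux : ∀ (l : Fin m) (p q : T.base.Cell) (x y : T.PCell) (_ : x = T.cls p)
        (_ : y = T.cls q) (h : T.ptgt l x = T.psrc l y),
        ∃ k : T.base.tgt l p = T.base.src l q, T.pcomp l x y h = T.cls (T.base.comp l p q k) := by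
      rintro l p q _ _ rfl rfl h; exact ⟨_, T.pcomp_cls l p q h⟩
    obtain ⟨k₁, e₁⟩ := aux i (T.base.comp j a b kab) (T.base.comp j c d kcd) _ _
      (T.pcomp_cls j a b hab) (T.pcomp_cls j c d hcd) h₁
    obtain ⟨k₂, e₂⟩ := aux j (T.base.comp i a c kac) (T.base.comp i b d kbd) _ _
      (T.pcomp_cls i a c hac) (T.pcomp_cls i b d hbd) h₂
    exact (e₁.trans (congrArg T.cls
      (T.base.exchange a b c d kab kcd kac kbd k₁ k₂ hl))).trans e₂.symm

/-- The quotient `m`-functor. -/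
def proj : T.base.Functor T.presented where
  map := T.cls
  map_src _ _ := rfl
  map_tgt _ _ := rfl
  map_comp i a b h h' := (T.cls_comp i a b h h').symm

/-- The pullback of a natural system on the presented category to the category of `m`-cells. -/
abbrev pullback (D : NCat.NatSys T.presented) : NCat.NatSys T.base := NCat.Ct.map T.proj ⋙ D

/-- A track category is linear when its natural system of closed cells is, up to isomorphism, the
pullback of an abelian natural system on the presented category. -/
def IsLinear : Prop :=
  ∃ D : NCat.NatSys T.presented, D.IsAbelian ∧ Nonempty (T.pullback D ≅ T.autSys)

variable {T} in
/-- Compatibility of an isomorphism between a pullback and the natural system of closed cells with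
conjugation: for `g : v → u`, so that `v` and `u` have the same class, the components at `v` and at
`u` differ by conjugation by `g`. -/
def IsConjInvariant {D : NCat.NatSys T.presented} (Ψ : T.pullback D ≅ T.autSys) : Prop :=
  ∀ {v u : T.base.Cell} (g : T.Arrow v u) (d : (T.pullback D).obj ⟨v⟩),
    (Ψ.hom.app ⟨u⟩ (D.map (eqToHom (congrArg NCat.Ct.mk g.cls_eq)) d) : T.Arrow u u) =
      g.conj (Ψ.hom.app ⟨v⟩ d : T.Arrow v v)

/-! ### The presented abelian groups -/

/-- A closed `(m + 1)`-cell whose base has class `x`. -/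
structure Gen (x : T.PCell) where
  /-- the base -/
  base : T.base.Cell
  /-- the closed cell -/
  cell : T.Arrow base base
  cls_base : T.cls base = x

/-- The defining relators: `[f ⋆ g] - ([f] + [g])` for `f` and `g` closed with the same base, and
`[f ⋆ g] - [g ⋆ f]` for `f : a → b` and `g : b → a`. -/
inductive IsRelator (x : T.PCell) : FreeAbelianGroup (T.Gen x) → Prop
  | add (a : T.base.Cell) (h : T.cls a = x) (f g : T.Arrow a a) :
      IsRelator x (FreeAbelianGroup.of ⟨a, f.comp g, h⟩ -
        (FreeAbelianGroup.of ⟨a, f, h⟩ + FreeAbelianGroup.of ⟨a, g, h⟩))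
  | swap (a b : T.base.Cell) (ha : T.cls a = x) (hb : T.cls b = x) (f : T.Arrow a b)
      (g : T.Arrow b a) :
      IsRelator x (FreeAbelianGroup.of ⟨a, f.comp g, ha⟩ -
        FreeAbelianGroup.of ⟨b, g.comp f, hb⟩)

/-- The abelian group with one generator for each closed cell over `x` and the relations above. -/
abbrev PiGroup (x : T.PCell) : Type w :=
  FreeAbelianGroup (T.Gen x) ⧸ AddSubgroup.closure {r | T.IsRelator x r}

variable {T} in
/-- The generator `[f]`, for a closed cell `f` whose base has class `x`. -/
def bracket {x : T.PCell} {a : T.base.Cell} (f : T.Arrow a a) (h : T.cls a = x) : T.PiGroup x :=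
  QuotientAddGroup.mk (FreeAbelianGroup.of ⟨a, f, h⟩)

/-- A natural system on the presented category whose groups are the presented groups `PiGroup`
(written multiplicatively) and in which a context `C` acts by `[f] ↦ [B[f]]`, for every context `B`
of the category of `m`-cells that starts at the base of `f` and lifts `C`. -/
structure PiSystem where
  /-- the natural system -/
  sys : NCat.NatSys T.presented
  /-- the identification of its groups -/
  equiv : ∀ x : T.PCell, sys.obj ⟨x⟩ ≃* Multiplicative (T.PiGroup x)
  map_bracket : ∀ {a b : NCat.Ct T.base} (B : a ⟶ b) (f : T.Arrow a.cell a.cell),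
    equiv (T.cls b.cell) (sys.map ((NCat.Ct.map T.proj).map B)
      ((equiv (T.cls a.cell)).symm (Multiplicative.ofAdd (bracket f rfl)))) =
    Multiplicative.ofAdd (bracket (f.actCtx B) rfl)

end TrackCat

end

/-!
Call closed cells `f : a → a` and `f' : b → b` conjugate when `f ⋆ k = k ⋆ f'` for some `k : a → b`
(`Arrow.ConjRel`). Conjugacy is compatible with all compositions (`Arrow.ConjRel.hcomp`), and the
group `Π(T)_x` is the universal abelian group receiving the closed cells over `x` multiplicatively
and conjugation invariantly (`piLift`, `piGroup_hom_ext`).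

A formal composite over the presented category lifts to one over the category of `m`-cells, by
choosing representatives of its cells: composability only depends on classes. Up to conjugacy, the
result of substituting a closed cell in a lift depends neither on the choices nor on the formal
composite up to the axioms of `m`-categories (`Lift.conjRel_act_of_rel`, `Lift.conjRel_act`). Hence
contexts of the presented category act on the groups `Π(T)`, which gives the natural system `piSys`,
and `f ↦ [f]` is a surjective natural transformation from the natural system of closed cells to its
pullback. None of this needs `T` to be abelian. If `T` is abelian, the conjugate `k⁻ ⋆ f ⋆ k` only
depends on `f` and on the target of `k` (`IsAbelian.conj_eq`), so that conjugating every closed cell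
over `u` to one based at `u` gives a retraction of `f ↦ [f]`: this transformation is an isomorphism,
and `Φ` is its inverse (`IsAbelian.piIso`). The converse is immediate, as the groups of a pullback
are groups of the original system.

For uniqueness, every context of the presented category lifts to the category of `m`-cells, and
every object does too. Therefore a morphism between pullbacks descends, uniquely, as soon as it
commutes with the identifications `D_{cls v} = D_{cls u}` given by arrows `v → u`
(`exists_whiskerLeft_proj_eq`). For `Φ⁻¹ ∘ Ψ` this is what conjugation invariance of `Φ` and `Ψ`
says.
-/

noncomputable section

namespace TrackCat

variable {m : ℕ} {T : TrackCat.{w} m}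

/-! ### Conjugate closed cells -/

namespace Arrow

/-- Conjugacy of closed cells, possibly with different bases. The equation is written without inverses,
so that it is visibly preserved by the lower compositions. -/
def ConjRel {a b : T.base.Cell} (f : T.Arrow a a) (f' : T.Arrow b b) : Prop :=
  ∃ k : T.Arrow a b, f.comp k = k.comp f'

theorem ConjRel.refl {a : T.base.Cell} (f : T.Arrow a a) : ConjRel f f :=
  ⟨id a, (comp_id f).trans (id_comp f).symm⟩

theorem ConjRel.symm {a b : T.base.Cell} {f : T.Arrow a a} {f' : T.Arrow b b}
    (h : ConjRel f f') : ConjRel f' f := by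
  obtain ⟨k, hk⟩ := h
  refine ⟨k.inv, ?_⟩
  rw [← id_comp (f'.comp k.inv), ← k.inv_comp, assoc, ← assoc k, ← hk, assoc f, comp_inv, comp_id]

theorem ConjRel.trans {a b c : T.base.Cell} {f : T.Arrow a a} {f' : T.Arrow b b}
    {f'' : T.Arrow c c} (h : ConjRel f f') (h' : ConjRel f' f'') : ConjRel f f'' := by
  obtain ⟨k, hk⟩ := h
  obtain ⟨l, hl⟩ := h'
  exact ⟨k.comp l, by rw [← assoc, hk, assoc, hl, assoc]⟩

theorem ConjRel.of_val_eq {a b : T.base.Cell} {f : T.Arrow a a} {f' : T.Arrow b b}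
    (h : f.1 = f'.1) : ConjRel f f' := by
  obtain rfl : a = b := Subtype.ext (f.2.1.symm.trans ((congrArg _ h).trans f'.2.1))
  obtain rfl : f = f' := ext h
  exact .refl f

theorem comp_conj {a b : T.base.Cell} (k : T.Arrow a b) (f : T.Arrow a a) :
    k.comp (k.conj f) = f.comp k := by
  rw [Arrow.conj, ← assoc, ← assoc, comp_inv, id_comp]

theorem conj_mul {a b : T.base.Cell} (k : T.Arrow a b) (f g : T.Arrow a a) :
    k.conj (f * g) = k.conj f * k.conj g := by
  rw [mul_def, mul_def, Arrow.conj, Arrow.conj, assoc _ k, comp_conj, assoc, assoc, assoc]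

theorem ConjRel.conj {a b : T.base.Cell} (k : T.Arrow a b) (f : T.Arrow a a) :
    ConjRel f (k.conj f) :=
  ⟨k, (comp_conj k f).symm⟩

theorem ConjRel.swap {a b : T.base.Cell} (f : T.Arrow a b) (g : T.Arrow b a) :
    ConjRel (f.comp g) (g.comp f) :=
  ⟨f, assoc f g f⟩

/-- Over a class, all identities are conjugate, whatever the arrow between their bases. -/
theorem ConjRel.id {a b : T.base.Cell} (h : T.cls a = T.cls b) :
    ConjRel (Arrow.id a) (Arrow.id b) := by
  obtain ⟨k⟩ := cls_eq_iff.1 h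
  exact ⟨k, (id_comp k).trans (comp_id k).symm⟩

/-- The `i`-composite of two `(m + 1)`-cells that need not be closed, for `i < m`. -/
def par (i : Fin m) {a a' b b' g g' : T.base.Cell} (h : T.base.tgt i a = T.base.src i b)
    (e : T.base.comp i a b h = g) (h' : T.base.tgt i a' = T.base.src i b')
    (e' : T.base.comp i a' b' h' = g') (k : T.Arrow a a') (l : T.Arrow b b') : T.Arrow g g' :=
  have hl := Fin.castSucc_lt_last i
  have hv : T.tgt i.castSucc a.1 = T.src i.castSucc b.1 := congrArg Subtype.val h
  have hv' : T.tgt i.castSucc a'.1 = T.src i.castSucc b'.1 := congrArg Subtype.val h'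
  have h₀ : T.tgt i.castSucc k.1 = T.src i.castSucc l.1 := by
    rw [← T.tgt_src_of_lt k.1 hl, ← T.src_src_of_lt l.1 hl, k.2.1, l.2.1, hv]
  ⟨T.comp i.castSucc k.1 l.1 h₀, by
    rw [T.src_comp_of_lt k.1 l.1 h₀ (by rw [k.2.1, l.2.1, hv]) hl, ← e]
    exact T.comp_congr _ k.2.1 l.2.1 _ _, by
    rw [T.tgt_comp_of_lt k.1 l.1 h₀ (by rw [k.2.2, l.2.2, hv']) hl, ← e']
    exact T.comp_congr _ k.2.2 l.2.2 _ _⟩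

/-- If `j` and `k` conjugate `f` to `f'` and `l` to `l'`, then `j ⋆ᵢ k` conjugates `f ⋆ᵢ l` to
`f' ⋆ᵢ l'`, by the exchange law. -/
theorem ConjRel.hcomp (i : Fin m) {a a' b b' g g' : T.base.Cell}
    (h : T.base.tgt i a = T.base.src i b) (e : T.base.comp i a b h = g)
    (h' : T.base.tgt i a' = T.base.src i b') (e' : T.base.comp i a' b' h' = g')
    {f : T.Arrow a a} {f' : T.Arrow a' a'} {l : T.Arrow b b} {l' : T.Arrow b' b'}
    (hf : ConjRel f f') (hl : ConjRel l l') :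
    ConjRel (Arrow.hcomp i h e f l) (Arrow.hcomp i h' e' f' l') := by
  obtain ⟨j, hj⟩ := hf
  obtain ⟨k, hk⟩ := hl
  refine ⟨par i h e h' e' j k, ext ?_⟩
  have hlt := Fin.castSucc_lt_last i
  have h₀ : T.tgt i.castSucc (f.comp j).1 = T.src i.castSucc (l.comp k).1 := by
    rw [← T.tgt_src_of_lt _ hlt, ← T.src_src_of_lt _ hlt, (f.comp j).2.1, (l.comp k).2.1]
    exact congrArg Subtype.val h
  have h₁ : T.tgt i.castSucc (j.comp f').1 = T.src i.castSucc (k.comp l').1 := by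
    rw [← hj, ← hk, h₀]
  exact (T.exchange _ _ _ _ _ _ _ _ h₀ _ hlt).symm.trans
    ((T.comp_congr _ (congrArg Subtype.val hj) (congrArg Subtype.val hk) h₀ h₁).trans
      (T.exchange _ _ _ _ _ _ _ _ h₁ _ hlt))

theorem id_hcomp_id (i : Fin m) {a b g : T.base.Cell} (h : T.base.tgt i a = T.base.src i b)
    (e : T.base.comp i a b h = g) : Arrow.hcomp i h e (Arrow.id a) (Arrow.id b) = Arrow.id g :=
  ext (congrArg (fun z : T.base.Cell => z.1) e)

end Arrow

/-! ### Lifting contexts of the presented category -/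

open Arrow NCat

/-- A formal composite of cells of the category of `m`-cells, with hole `u`, whose value at `u` has
class `y`. The value is a field, as it is only determined by `y` up to an arrow. -/
structure Lift (u : T.base.Cell) (y : T.PCell) where
  /-- the value at `u` -/
  val : T.base.Cell
  cls_val : T.cls val = y
  /-- the formal composite -/
  term : Term T.base u val

namespace Lift

theorem composable {u : T.base.Cell} {x y : T.PCell} (L : Lift u x) (M : Lift u y) {i : Fin m}
    (h : T.ptgt i x = T.psrc i y) : T.base.tgt i L.val = T.base.src i M.val := by
  obtain ⟨a, rfl, p⟩ := L
  obtain ⟨b, rfl, q⟩ := M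
  exact composable_of_cls h

/-- The `i`-composite of two lifts, which is defined as soon as that of the classes is. -/
def comp {u : T.base.Cell} {x y z : T.PCell} (i : Fin m) (L : Lift u x) (M : Lift u y)
    (h : T.ptgt i x = T.psrc i y) (e : T.pcomp i x y h = z) : Lift u z where
  val := T.base.comp i L.val M.val (L.composable M h)
  cls_val := by
    have hc := L.composable M h
    obtain ⟨a, rfl, p⟩ := L
    obtain ⟨b, rfl, q⟩ := M
    exact (T.cls_comp i a b hc h).symm.trans e
  term := L.term.comp i M.term (L.composable M h) rfl

/-- The lift of a formal composite over the presented category: each cell is replaced with its chosen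
representative, and the hole with a cell `u` in its class. -/
def of {u : T.base.Cell} {x : T.PCell} (hu : T.cls u = x) :
    ∀ {y : T.presented.Cell}, Term T.presented x y → Lift u y
  | y, .cell _ => ⟨T.rep y, T.cls_rep y, .cell _⟩
  | _, .hole => ⟨u, hu, .hole⟩
  | _, .comp i p q h e => (of hu p).comp i (of hu q) h e

theorem occ_of {u : T.base.Cell} {x : T.PCell} (hu : T.cls u = x) {y : T.presented.Cell}
    (p : Term T.presented x y) : (of hu p).term.occ = p.occ := by
  induction p with
  | cell y => rfl
  | hole => rfl
  | comp i p q h e ihp ihq => exact congrArg₂ (· + ·) ihp ihq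

/-- The image in the presented category of the lift of `p` is `p`. They have equal values, but not
definitionally, which is why `Term.Rel` relates terms of different types. -/
theorem rel_map_of {u : T.base.Cell} {y : T.presented.Cell} (p : Term T.presented (T.cls u) y) :
    Term.Rel T.presented (T.cls u) (Term.map T.proj (of rfl p).term) p := by
  induction p with
  | cell y =>
    have aux : ∀ z : T.presented.Cell, z = y →
        Term.Rel T.presented (T.cls u) (Term.cell z) (Term.cell y) := by
      rintro _ rfl; exact .refl _
    exact aux _ (T.cls_rep y)
  | hole => exact .refl _
  | comp i p q h e ihp ihq => exact .congr i _ _ _ _ ihp ihq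

theorem exists_rel_map {u : T.base.Cell} {y : T.PCell} (p : Term T.presented (T.cls u) y) :
    ∃ (g : T.base.Cell) (_ : T.cls g = y) (q : Term T.base u g),
      Term.Rel T.presented (T.cls u) (Term.map T.proj q) p ∧ q.occ = p.occ :=
  ⟨_, (of rfl p).cls_val, (of rfl p).term, rel_map_of p, occ_of rfl p⟩

/-- The axioms of `m`-categories hold strictly between lifts of general formal composites. Only the
lifts of cells, which are chosen, satisfy their relations up to an arrow, and these contribute
identities. -/
theorem conjRel_act_of_rel {u : T.base.Cell} {x : T.PCell} (hu : T.cls u = x) (f : T.Arrow u u)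
    {y z : T.presented.Cell} {p : Term T.presented x y} {q : Term T.presented x z}
    (h : Term.Rel T.presented x p q) :
    ConjRel (act f (of hu p).term) (act f (of hu q).term) := by
  induction h with
  | refl p => exact .refl _
  | symm _ ih => exact ih.symm
  | trans _ _ ih₁ ih₂ => exact ih₁.trans ih₂
  | congr i h e h' e' _ _ ih₁ ih₂ => exact .hcomp i _ _ _ _ ih₁ ih₂
  | @cell_comp i a b g h e =>
    refine .trans (.of_val_eq (congrArg Subtype.val (id_hcomp_id i
      ((of hu (.cell a)).composable (of hu (.cell b)) h) rfl))) (.id ?_)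
    exact ((of hu (.cell a)).comp i (of hu (.cell b)) h e).cls_val.trans (T.cls_rep g).symm
  | assoc i p q r h₁ e₁ h₂ e₂ h₃ e₃ h₄ e₄ => exact .of_val_eq (T.assoc _ _ _ _ _ _ _ _)
  | @id_comp i a g p h e =>
    have ht : T.base.tgt i (T.base.src i (of hu p).val) = T.base.src i (of hu p).val :=
      T.base.tgt_src_of_le _ le_rfl
    refine .trans (.hcomp i _ _ ht (T.base.id_comp i _ ht) (f' := Arrow.id _) (.id ?_) (.refl _))
      (.of_val_eq (act_rel f (.id_comp i (of hu p).term ht (T.base.id_comp i _ ht))))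
    exact (T.cls_rep _).trans (congrArg (T.psrc i) (of hu p).cls_val.symm)
  | @comp_id i a g p h e =>
    have ht : T.base.tgt i (of hu p).val = T.base.src i (T.base.tgt i (of hu p).val) :=
      (T.base.src_tgt_of_le _ le_rfl).symm
    refine .trans (.hcomp i _ _ ht (T.base.comp_id i _ ht) (l' := Arrow.id _) (.refl _) (.id ?_))
      (.of_val_eq (act_rel f (.comp_id i (of hu p).term ht (T.base.comp_id i _ ht))))
    exact (T.cls_rep _).trans (congrArg (T.ptgt i) (of hu p).cls_val.symm)
  | exchange hij p q r s hab eab hcd ecd hac eac hbd ebd h₁ e₁ h₂ e₂ =>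
    exact .of_val_eq (T.exchange _ _ _ _ _ _ _ _ _ _ hij)

/-- The action of a lifted formal composite does not depend on the choice of the hole in its class. -/
theorem conjRel_act {u v : T.base.Cell} {x : T.PCell} (hu : T.cls u = x) (hv : T.cls v = x)
    {f : T.Arrow u u} {f' : T.Arrow v v} (hf : ConjRel f f') {y : T.presented.Cell}
    (p : Term T.presented x y) : ConjRel (act f (of hu p).term) (act f' (of hv p).term) := by
  induction p with
  | cell y => exact .refl _
  | hole => exact hf
  | comp i p q h e ihp ihq => exact .hcomp i _ _ _ _ ihp ihq

/-- A formal composite acts, up to conjugacy, as any other lift of its image. -/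
theorem conjRel_act_map {u : T.base.Cell} (f : T.Arrow u u) {g : T.base.Cell}
    (p : Term T.base u g) : ConjRel (act f p) (act f (of rfl (Term.map T.proj p)).term) := by
  induction p with
  | cell a => exact .id (T.cls_rep (T.cls a)).symm
  | hole => exact .refl _
  | comp i p q h e ihp ihq => exact .hcomp i _ _ _ _ ihp ihq

theorem conjRel_act_subst {u : T.base.Cell} {x : T.PCell} (hu : T.cls u = x) (f : T.Arrow u u)
    {y z : T.presented.Cell} (t : Term T.presented x y) (p : Term T.presented y z) :
    ConjRel (act f (of hu (Term.subst t p)).term)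
      (act (act f (of hu t).term) (of (of hu t).cls_val p).term) := by
  induction p with
  | cell a => exact .refl _
  | hole => exact .refl _
  | comp i p q h e ihp ihq => exact .hcomp i _ _ _ _ ihp ihq

end Lift

/-! ### The natural system of presented groups -/

theorem bracket_mul {x : T.PCell} {a : T.base.Cell} (f g : T.Arrow a a) (h : T.cls a = x) :
    bracket (f * g) h = bracket f h + bracket g h := by
  refine (sub_eq_zero.1 ?_)
  exact (QuotientAddGroup.eq_zero_iff _).2 (AddSubgroup.subset_closure (.add a h f g))

theorem bracket_eq_of_conjRel {x : T.PCell} {a b : T.base.Cell} {f : T.Arrow a a}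
    {g : T.Arrow b b} (ha : T.cls a = x) (hb : T.cls b = x) (h : ConjRel f g) :
    bracket f ha = bracket g hb := by
  -- `f = k ⋆ (g ⋆ k⁻)` and `g = (g ⋆ k⁻) ⋆ k` are the two sides of a defining relation
  obtain ⟨k, hk⟩ := h
  have h₁ : f = k.comp (g.comp k.inv) := by
    rw [← Arrow.assoc, ← hk, Arrow.assoc, comp_inv, Arrow.comp_id]
  have h₂ : g = (g.comp k.inv).comp k := by
    rw [Arrow.assoc, inv_comp, Arrow.comp_id]
  rw [h₁]
  conv_rhs => rw [h₂]
  exact sub_eq_zero.1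
    ((QuotientAddGroup.eq_zero_iff _).2 (AddSubgroup.subset_closure (.swap a b ha hb _ _)))

/-- The homomorphism out of `Π(T)_x` determined by a function on the closed cells over `x` that is
additive on each group of closed cells and invariant under conjugacy. -/
def piLift {x : T.PCell} {A : Type*} [AddCommGroup A]
    (φ : ∀ a : T.base.Cell, T.cls a = x → T.Arrow a a → A)
    (hmul : ∀ a (h : T.cls a = x) (f g : T.Arrow a a), φ a h (f * g) = φ a h f + φ a h g)
    (hconj : ∀ a b (ha : T.cls a = x) (hb : T.cls b = x) (f : T.Arrow a a) (g : T.Arrow b b),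
      ConjRel f g → φ a ha f = φ b hb g) : T.PiGroup x →+ A :=
  QuotientAddGroup.lift _ (FreeAbelianGroup.lift fun s => φ s.base s.cls_base s.cell) (by
    rw [AddSubgroup.closure_le]
    rintro _ (⟨a, h, f, g⟩ | ⟨a, b, ha, hb, f, g⟩)
    · change FreeAbelianGroup.lift _ _ = 0
      simp only [map_sub, map_add, FreeAbelianGroup.lift_apply_of]
      exact sub_eq_zero.2 (hmul a h f g)
    · change FreeAbelianGroup.lift _ _ = 0
      simp only [map_sub, FreeAbelianGroup.lift_apply_of]
      exact sub_eq_zero.2 (hconj a b ha hb _ _ (.swap f g)))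

theorem piLift_bracket {x : T.PCell} {A : Type*} [AddCommGroup A]
    (φ : ∀ a : T.base.Cell, T.cls a = x → T.Arrow a a → A) (hmul hconj) {a : T.base.Cell}
    (f : T.Arrow a a) (h : T.cls a = x) : piLift φ hmul hconj (bracket f h) = φ a h f := by
  refine (QuotientAddGroup.lift_mk _ _ _).trans ?_
  exact FreeAbelianGroup.lift_apply_of _ _

theorem piGroup_hom_ext {x : T.PCell} {A : Type*} [AddCommGroup A] {φ ψ : T.PiGroup x →+ A}
    (h : ∀ (a : T.base.Cell) (f : T.Arrow a a) (ha : T.cls a = x),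
      φ (bracket f ha) = ψ (bracket f ha)) : φ = ψ :=
  QuotientAddGroup.addMonoidHom_ext _
    (FreeAbelianGroup.lift_ext _ _ fun s => h s.base s.cell s.cls_base)

/-- The action of a formal composite over the presented category: `[f]` is sent to the class of the
result of substituting `f` in a lift. -/
def piAct {x y : T.PCell} (p : Term T.presented x y) : T.PiGroup x →+ T.PiGroup y :=
  piLift (fun _ h f => bracket (act f (Lift.of h p).term) (Lift.of h p).cls_val)
    (fun a h f g => by rw [act_mul, bracket_mul])
    (fun _ _ ha hb _ _ h => bracket_eq_of_conjRel _ _ (Lift.conjRel_act ha hb h p))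

theorem piAct_bracket {x y : T.PCell} (p : Term T.presented x y) {a : T.base.Cell}
    (f : T.Arrow a a) (h : T.cls a = x) :
    piAct p (bracket f h) = bracket (act f (Lift.of h p).term) (Lift.of h p).cls_val :=
  piLift_bracket _ _ _ f h

theorem piAct_eq_of_rel {x y : T.PCell} {p q : Term T.presented x y}
    (h : Term.Rel T.presented x p q) : piAct p = piAct q :=
  piGroup_hom_ext fun _ f ha => by
    rw [piAct_bracket, piAct_bracket]
    exact bracket_eq_of_conjRel _ _ (Lift.conjRel_act_of_rel ha f h)

theorem piAct_hole (x : T.PCell) :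
    piAct (.hole : Term T.presented x x) = AddMonoidHom.id (T.PiGroup x) :=
  piGroup_hom_ext fun _ f ha => piAct_bracket _ f ha

theorem piAct_subst {x y z : T.PCell} (p : Term T.presented x y) (q : Term T.presented y z) :
    piAct (Term.subst p q) = (piAct q).comp (piAct p) :=
  piGroup_hom_ext fun _ f ha => by
    rw [AddMonoidHom.comp_apply, piAct_bracket, piAct_bracket, piAct_bracket]
    exact bracket_eq_of_conjRel _ _ (Lift.conjRel_act_subst ha f p q)

theorem piAct_map_bracket {u g : T.base.Cell} (p : Term T.base u g) (f : T.Arrow u u) :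
    piAct (Term.map T.proj p) (bracket f rfl) = (bracket (act f p) rfl : T.PiGroup (T.cls g)) :=
  (piAct_bracket (Term.map T.proj p) f rfl).trans
    (bracket_eq_of_conjRel _ _ (Lift.conjRel_act_map f p).symm)

variable (T) in
/-- The natural system `Π(T)`. Its groups are written multiplicatively. -/
def piSys : NatSys T.presented where
  obj x := GrpCat.of (Multiplicative (T.PiGroup x.cell))
  map {x y} K := GrpCat.ofHom (AddMonoidHom.toMultiplicative
    (Quotient.liftOn K (fun p => piAct p.1) (fun _ _ h => piAct_eq_of_rel h)))
  map_id x := congrArg (fun φ => GrpCat.ofHom (AddMonoidHom.toMultiplicative φ)) (piAct_hole x.cell)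
  map_comp := by
    rintro ⟨x⟩ ⟨y⟩ ⟨z⟩ ⟨p⟩ ⟨q⟩
    exact congrArg (fun φ => GrpCat.ofHom (AddMonoidHom.toMultiplicative φ)) (piAct_subst p.1 q.1)

variable (T) in
/-- The natural system `Π(T)`, with the tautological identification of its groups. -/
def piSystem : T.PiSystem where
  sys := T.piSys
  equiv x := MulEquiv.refl _
  map_bracket := by
    rintro ⟨a⟩ ⟨b⟩ ⟨p⟩ f
    exact congrArg Multiplicative.ofAdd (piAct_map_bracket p.1 f)

theorem piSys_isAbelian : T.piSys.IsAbelian := fun x a b =>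
  mul_comm (G := Multiplicative (T.PiGroup x.cell)) a b

theorem piSys_map_eqToHom {x y : T.PCell} (h : x = y) {a : T.base.Cell} (f : T.Arrow a a)
    (ha : T.cls a = x) :
    T.piSys.map (eqToHom (congrArg Ct.mk h)) (Multiplicative.ofAdd (bracket f ha)) =
      (Multiplicative.ofAdd (bracket f (ha.trans h)) : Multiplicative (T.PiGroup y)) := by
  subst h
  rw [eqToHom_refl, T.piSys.map_id]
  rfl

/-- Every element of `Π(T)` over the class of `u` is the class of a closed cell based at `u`: every
closed cell over that class is conjugate to such a cell, and the classes of these form a subgroup. -/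
theorem exists_bracket_eq {u : T.base.Cell} (z : T.PiGroup (T.cls u)) :
    ∃ f : T.Arrow u u, bracket f rfl = z := by
  obtain ⟨z, rfl⟩ := QuotientAddGroup.mk_surjective z
  let φ : Additive (T.Arrow u u) →+ T.PiGroup (T.cls u) :=
    AddMonoidHom.mk' (fun f => bracket f.toMul rfl) (fun f g => bracket_mul f.toMul g.toMul rfl)
  have key (s : T.Gen (T.cls u)) : ∃ f, φ f = bracket s.cell s.cls_base := by
    obtain ⟨k⟩ := cls_eq_iff.1 s.cls_base
    exact ⟨Additive.ofMul (k.conj s.cell), (bracket_eq_of_conjRel _ _ (.conj k s.cell)).symm⟩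
  suffices h : ∃ f, φ f = z from h
  induction z using FreeAbelianGroup.induction_on with
  | zero => exact ⟨0, map_zero φ⟩
  | of s => exact key s
  | neg s _ =>
    obtain ⟨f, hf⟩ := key s
    exact ⟨-f, (map_neg φ f).trans (congrArg Neg.neg hf)⟩
  | add y z hy hz =>
    obtain ⟨f, hf⟩ := hy
    obtain ⟨g, hg⟩ := hz
    exact ⟨f + g, (map_add φ f g).trans (congrArg₂ (· + ·) hf hg)⟩

/-! ### The isomorphism with closed cells -/

/-- In an abelian track category, conjugates do not depend on the conjugating arrow: two of them
differ by a closed cell, which is central. -/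
theorem IsAbelian.conj_eq (hT : T.IsAbelian) {a b : T.base.Cell} {f : T.Arrow a a}
    {f' : T.Arrow b b} (h : ConjRel f f') (k : T.Arrow a b) : k.conj f = f' := by
  obtain ⟨l, hl⟩ := h
  have h₂ : f.comp k = k.comp f' := by
    have h₃ : k = l.comp (l.inv.comp k) := by rw [← Arrow.assoc, comp_inv, Arrow.id_comp]
    have h₄ : (l.inv.comp k).comp f' = f'.comp (l.inv.comp k) := hT b _ _
    rw [h₃, ← Arrow.assoc, hl, Arrow.assoc, Arrow.assoc, h₄]
  rw [Arrow.conj, Arrow.assoc, h₂, ← Arrow.assoc, inv_comp, Arrow.id_comp]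

/-- The retraction of `f ↦ [f]` conjugates every closed cell over the class of `u` to a closed cell
based at `u`, by an arbitrary arrow. -/
theorem IsAbelian.bracket_injective (hT : T.IsAbelian) {u : T.base.Cell} {f g : T.Arrow u u}
    (h : (bracket f rfl : T.PiGroup (T.cls u)) = bracket g rfl) : f = g := by
  let _ : CommGroup (T.Arrow u u) := { (inferInstance : Group (T.Arrow u u)) with mul_comm := hT u }
  let k (a : T.base.Cell) (ha : T.cls a = T.cls u) : T.Arrow a u := (cls_eq_iff.1 ha).some
  let ψ : T.PiGroup (T.cls u) →+ Additive (T.Arrow u u) :=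
    piLift (fun a ha f => Additive.ofMul ((k a ha).conj f))
      (fun a ha f g => congrArg Additive.ofMul (conj_mul (k a ha) f g))
      (fun a b ha hb f g hfg =>
        congrArg Additive.ofMul (hT.conj_eq (hfg.trans (.conj (k b hb) g)) (k a ha)))
  have hψ (f : T.Arrow u u) : ψ (bracket f rfl) = Additive.ofMul f :=
    (piLift_bracket _ _ _ f rfl).trans
      (congrArg Additive.ofMul (hT.conj_eq (.refl f) (k u rfl)))
  exact Additive.ofMul.injective ((hψ f).symm.trans ((congrArg ψ h).trans (hψ g)))

/-- The isomorphism `f ↦ [f]` from the closed cells based at `u` to the group `Π(T)` over the class of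
`u`. -/
def IsAbelian.bracketEquiv (hT : T.IsAbelian) (u : T.base.Cell) :
    T.Arrow u u ≃* Multiplicative (T.PiGroup (T.cls u)) :=
  MulEquiv.ofBijective
    (MonoidHom.mk' (fun f => Multiplicative.ofAdd (bracket f rfl)) (fun f g => bracket_mul f g rfl))
    ⟨fun _ _ h => hT.bracket_injective h, fun z => exists_bracket_eq z⟩

/-- The isomorphism from the pullback of `Π(T)` to the natural system of closed cells, inverse to
`f ↦ [f]`. -/
def IsAbelian.piIso (hT : T.IsAbelian) : T.pullback T.piSys ≅ T.autSys :=
  (NatIso.ofComponents (fun u => (hT.bracketEquiv u.cell).toGrpIso) (by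
    rintro ⟨a⟩ ⟨b⟩ ⟨p⟩
    ext f
    exact (congrArg Multiplicative.ofAdd (piAct_map_bracket p.1 f)).symm)).symm

theorem IsAbelian.piIso_bracket (hT : T.IsAbelian) {v u : T.base.Cell} (g : T.Arrow v u)
    (f : T.Arrow v v) :
    (hT.piIso.hom.app ⟨u⟩ (Multiplicative.ofAdd (bracket f g.cls_eq)) : T.Arrow u u) =
      g.conj f := by
  refine (MulEquiv.symm_apply_eq (hT.bracketEquiv u)).2 ?_
  exact congrArg Multiplicative.ofAdd (bracket_eq_of_conjRel g.cls_eq rfl (.conj g f))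

theorem IsAbelian.isConjInvariant_piIso (hT : T.IsAbelian) : IsConjInvariant hT.piIso := by
  intro v u g d
  obtain ⟨f, rfl⟩ : ∃ f : T.Arrow v v, Multiplicative.ofAdd (bracket f rfl) = d :=
    exists_bracket_eq (T := T) d
  have h₁ := (congrArg (fun z => (hT.piIso.hom.app ⟨u⟩ z : T.Arrow u u))
    (piSys_map_eqToHom g.cls_eq f rfl)).trans (hT.piIso_bracket g f)
  have h₂ : (hT.piIso.hom.app ⟨v⟩ (Multiplicative.ofAdd (bracket f rfl)) : T.Arrow v v) = f :=
    (hT.bracketEquiv v).symm_apply_apply f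
  exact h₁.trans (congrArg g.conj h₂.symm)

/-! ### Descent of morphisms to the presented category -/

/-- Contexts of the presented category lift to contexts of the category of `m`-cells, with a
prescribed lift of the source. -/
theorem exists_map_proj_eq {u : T.base.Cell} {y : Ct T.presented}
    (K : (Ct.map T.proj).obj ⟨u⟩ ⟶ y) :
    ∃ (g : T.base.Cell) (B : (⟨u⟩ : Ct T.base) ⟶ ⟨g⟩) (h : (Ct.map T.proj).obj ⟨g⟩ = y),
      (Ct.map T.proj).map B ≫ eqToHom h = K := by
  obtain ⟨y⟩ := y
  obtain ⟨p, hp⟩ := K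
  obtain ⟨g, rfl, q, hr, ho⟩ := Lift.exists_rel_map p
  exact ⟨g, Context.mk q (ho.trans hp), rfl, (Category.comp_id _).trans (Quotient.sound hr)⟩

theorem whiskerLeft_proj_injective {D D' : NatSys T.presented} {θ θ' : D ⟶ D'}
    (h : Functor.whiskerLeft (Ct.map T.proj) θ = Functor.whiskerLeft (Ct.map T.proj) θ') :
    θ = θ' := by
  ext ⟨⟨u⟩⟩ : 2
  exact congrArg (fun α => α.app (⟨u⟩ : Ct T.base)) h

theorem map_eqToHom_comp_map_eqToHom_comp {C : NCat.{w} m} (D : NatSys C) {x y : Ct C} (h : x = y)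
    {z : GrpCat.{w}} (f : D.obj x ⟶ z) :
    D.map (eqToHom h) ≫ D.map (eqToHom h.symm) ≫ f = f := by
  subst h
  simp

/-- A morphism between pullbacks descends if it is compatible with the identifications of groups over
cells of the same class. -/
theorem exists_whiskerLeft_proj_eq {D D' : NatSys T.presented}
    (α : T.pullback D ⟶ T.pullback D')
    (hα : ∀ {v u : T.base.Cell} (g : T.Arrow v u),
      D.map (eqToHom (congrArg Ct.mk g.cls_eq)) ≫ α.app ⟨u⟩ =
        α.app ⟨v⟩ ≫ D'.map (eqToHom (congrArg Ct.mk g.cls_eq))) :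
    ∃ θ : D ⟶ D', Functor.whiskerLeft (Ct.map T.proj) θ = α := by
  -- the component at `x` is that of `α` at a representative of `x`
  let app (x : Ct T.presented) : D.obj x ⟶ D'.obj x :=
    D.map (eqToHom (congrArg Ct.mk (T.cls_rep x.cell).symm)) ≫ α.app ⟨T.rep x.cell⟩ ≫
      D'.map (eqToHom (congrArg Ct.mk (T.cls_rep x.cell)))
  have happ (u : T.base.Cell) : app ⟨T.cls u⟩ = α.app ⟨u⟩ := by
    obtain ⟨k⟩ := cls_eq_iff.1 (T.cls_rep (T.cls u))
    have h := hα k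
    refine (congrArg (D.map (eqToHom _) ≫ ·) h.symm).trans ?_
    exact map_eqToHom_comp_map_eqToHom_comp D
      (congrArg Ct.mk (T.cls_rep (T.cls u)).symm : (⟨T.cls u⟩ : Ct T.presented) = _) _
  refine ⟨⟨app, ?_⟩, ?_⟩
  · rintro ⟨⟨u⟩⟩ y K
    obtain ⟨g, B, rfl, rfl⟩ := exists_map_proj_eq K
    rw [eqToHom_refl, Category.comp_id]
    exact (congrArg (_ ≫ ·) (happ g)).trans ((α.naturality B).trans
      (congrArg (· ≫ _) (happ u).symm))
  · ext ⟨u⟩ : 2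
    exact happ u

/-- Both sides of the compatibility needed for `Ψ.hom ≫ Φ.inv` to descend are conjugation by an arrow
`g`, once composed with `Φ`. -/
theorem IsConjInvariant.exists_hom {D D' : NatSys T.presented} {Ψ : T.pullback D ≅ T.autSys}
    {Φ : T.pullback D' ≅ T.autSys} (hΨ : IsConjInvariant Ψ) (hΦ : IsConjInvariant Φ) :
    ∃ θ : D ⟶ D', Functor.whiskerLeft (Ct.map T.proj) θ = Ψ.hom ≫ Φ.inv := by
  refine exists_whiskerLeft_proj_eq _ fun {v u} g => ?_
  refine (cancel_mono (Φ.hom.app ⟨u⟩)).1 ?_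
  ext d
  have hinv (w : T.base.Cell) (z : T.autSys.obj ⟨w⟩) : Φ.hom.app ⟨w⟩ (Φ.inv.app ⟨w⟩ z) = z :=
    congrArg (fun β => β.app (⟨w⟩ : Ct T.base) z) Φ.inv_hom_id
  have h₁ := hΦ g (Φ.inv.app ⟨v⟩ (Ψ.hom.app ⟨v⟩ d))
  rw [hinv] at h₁
  exact (hinv u _).trans ((hΨ g d).trans h₁.symm)

theorem IsConjInvariant.existsUnique_iso {D D' : NatSys T.presented}
    {Ψ : T.pullback D ≅ T.autSys} {Φ : T.pullback D' ≅ T.autSys} (hΨ : IsConjInvariant Ψ)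
    (hΦ : IsConjInvariant Φ) :
    ∃! θ : D ≅ D', Functor.whiskerLeft (Ct.map T.proj) θ.hom ≫ Φ.hom = Ψ.hom := by
  obtain ⟨θ, hθ⟩ := hΨ.exists_hom hΦ
  obtain ⟨θ', hθ'⟩ := hΦ.exists_hom hΨ
  refine ⟨⟨θ, θ', whiskerLeft_proj_injective ?_, whiskerLeft_proj_injective ?_⟩, ?_, ?_⟩
  · simp [Functor.whiskerLeft_comp, hθ, hθ']
  · simp [Functor.whiskerLeft_comp, hθ, hθ']
  · simp [hθ]
  · intro θ₁ h₁
    refine Iso.ext (whiskerLeft_proj_injective ?_)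
    rw [hθ, ← h₁, Category.assoc, Iso.hom_inv_id, Category.comp_id]

theorem IsLinear.isAbelian (h : T.IsLinear) : T.IsAbelian := by
  obtain ⟨D, hD, ⟨Ψ⟩⟩ := h
  intro u f g
  let e := (Ψ.app ⟨u⟩).groupIsoToMulEquiv
  exact e.symm.injective ((map_mul e.symm f g).trans
    ((hD _ _ _).trans (map_mul e.symm g f).symm))

theorem nonempty_mulEquiv_of_iso {D D' : NatSys T.presented} (Ψ : T.pullback D ≅ T.autSys)
    (Φ : T.pullback D' ≅ T.autSys) (x : T.PCell) : Nonempty (D.obj ⟨x⟩ ≃* D'.obj ⟨x⟩) := by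
  obtain ⟨u⟩ := x
  exact ⟨((Ψ ≪≫ Φ.symm).app (⟨u⟩ : Ct T.base)).groupIsoToMulEquiv⟩

end TrackCat

end

theorem theorem1 {m : ℕ} (T : TrackCat.{w} m) :
    (T.IsAbelian ↔ T.IsLinear) ∧
    (T.IsAbelian →
      ∃ (P : T.PiSystem) (Φ : T.pullback P.sys ≅ T.autSys),
        P.sys.IsAbelian ∧
        (∀ {v u : T.base.Cell} (g : T.Arrow v u) (f : T.Arrow v v),
          (Φ.hom.app ⟨u⟩
            ((P.equiv (T.cls u)).symm (Multiplicative.ofAdd (TrackCat.bracket f g.cls_eq))) :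
              T.Arrow u u) = g.conj f) ∧
        TrackCat.IsConjInvariant Φ ∧
        (∀ (D : NCat.NatSys T.presented) (Ψ : T.pullback D ≅ T.autSys),
          TrackCat.IsConjInvariant Ψ →
          ∃! θ : D ≅ P.sys,
            Functor.whiskerLeft (NCat.Ct.map T.proj) θ.hom ≫ Φ.hom = Ψ.hom) ∧
        (∀ D : NCat.NatSys T.presented, Nonempty (T.pullback D ≅ T.autSys) →
          ∀ x : T.PCell, Nonempty (D.obj ⟨x⟩ ≃* P.sys.obj ⟨x⟩))) := by
  refine ⟨⟨fun hT => ⟨T.piSys, TrackCat.piSys_isAbelian, ⟨hT.piIso⟩⟩, fun h => h.isAbelian⟩,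
    fun hT => ⟨T.piSystem, hT.piIso, TrackCat.piSys_isAbelian, ?_, hT.isConjInvariant_piIso, ?_, ?_⟩⟩
  · exact fun g f => hT.piIso_bracket g f
  · exact fun D Ψ hΨ => hΨ.existsUnique_iso hT.isConjInvariant_piIso
  · exact fun D ⟨Ψ⟩ x => TrackCat.nonempty_mulEquiv_of_iso Ψ hT.piIso x
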